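/- Let $d\ge 1$ and $k\ge 0$ be integers, let $\Omega\subset\mathbb{R}^d$ be a non-empty open set, and let $\lambda$ denote Lebesgue measure. Let $W^{k,1}(\Omega)$ be the Sobolev space of all real-valued $u\in L^1(\Omega)$ whose weak derivatives $D^\alpha u$ exist and belong to $L^1(\Omega)$ for all multi-indices $\alpha\in\mathbb{N}^d$ with $|\alpha|\le k$, with the norm $\|u\|_{W^{k,1}(\Omega)}=\sum_{|\alpha|\le k}\int_\Omega|D^\alpha u|\,\mathrm{d}\lambda$ (so $W^{0,1}(\Omega)=L^1(\Omega)$). Let $\mathcal{F}\subset W^{k,1}(\Omega)$. Then the following are equivalent. 1. The following three conditions hold: (a) there is a constant $M>0$ such that $\|f\|_{W^{k,1}(\Omega)}\le M$ for every $f\in\mathcal{F}$; (b) there is a function $\delta\colon(0,\infty)\to(0,\infty)$ such that for every $f\in\mathcal{F}$, every $\varepsilon>0$ and every measurable $A\subset\Omega$ with $\lambda(A)<\delta(\varepsilon)$, $$\sum_{|\alpha|\le k}\int_A|D^\alpha f|\,\mathrm{d}\lambda<\varepsilon;$$ (c) there is a map $\omega\colon(0,\infty)\to 2^{\Omega}$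 such that every $\omega(\varepsilon)$ is measurable with $\lambda(\omega(\varepsilon))<\infty$, and for every $f\in\mathcal{F}$ and every $\varepsilon>0$, $$\sum_{|\alpha|\le k}\int_{\Omega\setminus\omega(\varepsilon)}|D^\alpha f|\,\mathrm{d}\lambda<\varepsilon.$$ 2. $\mathcal{F}$ is relatively weakly compact in $W^{k,1}(\Omega)$, that is, the closure of $\mathcal{F}$ in the weak topology $\sigma\bigl(W^{k,1}(\Omega),W^{k,1}(\Omega)^\star\bigr)$ is compact in that topology. -/

import Mathlib

open MeasureTheory TopologicalSpace Distributions LineDeriv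

noncomputable section

/-- The multi-indices `α ∈ ℕ^d` of length `|α| = α₁ + ⋯ + α_d ≤ k`. -/
def multiIndices (d k : ℕ) : Finset (Fin d → ℕ) :=
  (Fintype.piFinset fun _ => Finset.range (k + 1)).filter fun α => ∑ i, α i ≤ k

theorem mem_multiIndices {d k : ℕ} {α : Fin d → ℕ} :
    α ∈ multiIndices d k ↔ ∑ i, α i ≤ k := by
  simp only [multiIndices, Finset.mem_filter, Fintype.mem_piFinset, Finset.mem_range,
    and_iff_right_iff_imp]
  intro h i
  have := Finset.single_le_sum (f := α) (fun j _ => Nat.zero_le _) (Finset.mem_univ i)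
  omega

/-- The classical partial derivative `D^α φ = ∂₁^{α₁} ⋯ ∂_d^{α_d} φ` of a test function
`φ ∈ C_c^∞(Ω)`. -/
def testDeriv {d : ℕ} {Ω : Opens (EuclideanSpace ℝ (Fin d))} (α : Fin d → ℕ)
    (φ : 𝓓(Ω, ℝ)) : 𝓓(Ω, ℝ) :=
  (List.finRange d).foldr (fun i ψ => (∂_{EuclideanSpace.single i (1 : ℝ)})^[α i] ψ) φ

/-- `v` is an `α`-th weak derivative of `u` on `Ω`:
`∫_Ω u D^α φ = (-1)^{|α|} ∫_Ω v φ` for every `φ ∈ C_c^∞(Ω)`. -/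
def IsWeakDeriv {d : ℕ} (Ω : Opens (EuclideanSpace ℝ (Fin d))) (α : Fin d → ℕ)
    (u v : EuclideanSpace ℝ (Fin d) → ℝ) : Prop :=
  ∀ φ : 𝓓(Ω, ℝ), ∫ x in Ω, u x * testDeriv α φ x = (-1) ^ (∑ i, α i) * ∫ x in Ω, v x * φ x

/-- The Lebesgue space `L¹(Ω)` of (classes of) real-valued functions. -/
abbrev L1Space {d : ℕ} (Ω : Opens (EuclideanSpace ℝ (Fin d))) : Type :=
  Lp ℝ 1 (volume.restrict (Ω : Set (EuclideanSpace ℝ (Fin d))))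

section basic

variable {d : ℕ} {Ω : Opens (EuclideanSpace ℝ (Fin d))} {α : Fin d → ℕ}

theorem testDeriv_zero (φ : 𝓓(Ω, ℝ)) : testDeriv 0 φ = φ := by
  unfold testDeriv
  induction List.finRange d with
  | nil => rfl
  | cons i l _ => simp

theorem L1Space.integrable_mul_test (u : L1Space Ω) (φ : 𝓓(Ω, ℝ)) :
    Integrable (fun x => u x * φ x) (volume.restrict (Ω : Set (EuclideanSpace ℝ (Fin d)))) := by
  have hu := L1.integrable_coeFn u
  obtain ⟨C, hC⟩ := φ.continuous.bounded_above_of_compact_support φ.hasCompactSupport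
  exact hu.mul_bdd (c := C) φ.aestronglyMeasurable (Filter.Eventually.of_forall hC)

theorem IsWeakDeriv.zero : IsWeakDeriv Ω α (0 : L1Space Ω) (0 : L1Space Ω) := by
  intro φ
  have h : ∀ ψ : 𝓓(Ω, ℝ), ∫ x in Ω, (0 : L1Space Ω) x * ψ x = 0 := fun ψ => by
    rw [integral_congr_ae (g := fun _ => (0 : ℝ)), integral_zero]
    filter_upwards [Lp.coeFn_zero ℝ 1
      (volume.restrict (Ω : Set (EuclideanSpace ℝ (Fin d))))] with x hx
    rw [hx, Pi.zero_apply, zero_mul]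
  rw [h, h, mul_zero]

theorem IsWeakDeriv.add {u₁ u₂ v₁ v₂ : L1Space Ω} (h₁ : IsWeakDeriv Ω α u₁ v₁)
    (h₂ : IsWeakDeriv Ω α u₂ v₂) :
    IsWeakDeriv Ω α (u₁ + u₂ : L1Space Ω) (v₁ + v₂ : L1Space Ω) := by
  intro φ
  have h : ∀ (a b : L1Space Ω) (ψ : 𝓓(Ω, ℝ)), ∫ x in Ω, (a + b : L1Space Ω) x * ψ x
      = (∫ x in Ω, a x * ψ x) + ∫ x in Ω, b x * ψ x := fun a b ψ => by
    rw [← integral_add (a.integrable_mul_test ψ) (b.integrable_mul_test ψ)]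
    refine integral_congr_ae ?_
    filter_upwards [Lp.coeFn_add a b] with x hx
    rw [hx, Pi.add_apply, add_mul]
  rw [h, h, h₁ φ, h₂ φ, mul_add]

theorem IsWeakDeriv.smul (c : ℝ) {u v : L1Space Ω} (h₁ : IsWeakDeriv Ω α u v) :
    IsWeakDeriv Ω α (c • u : L1Space Ω) (c • v : L1Space Ω) := by
  intro φ
  have h : ∀ (a : L1Space Ω) (ψ : 𝓓(Ω, ℝ)), ∫ x in Ω, (c • a : L1Space Ω) x * ψ x
      = c * ∫ x in Ω, a x * ψ x := fun a ψ => by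
    rw [← integral_const_mul]
    refine integral_congr_ae ?_
    filter_upwards [Lp.coeFn_smul c a] with x hx
    rw [hx, Pi.smul_apply, smul_eq_mul, mul_assoc]
  rw [h, h, h₁ φ]
  ring

theorem IsWeakDeriv.unique {u v w : L1Space Ω} (h₁ : IsWeakDeriv Ω α u v)
    (h₂ : IsWeakDeriv Ω α u w) : v = w := by
  have hv := L1.integrable_coeFn v
  have hw := L1.integrable_coeFn w
  have key := Ω.isOpen.ae_eq_zero_of_integral_contDiff_smul_eq_zero (μ := volume)
    (f := fun x => v x - w x) (IntegrableOn.locallyIntegrableOn (hv.sub hw)) (by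
      intro g hg hgc hgs
      let φ : 𝓓(Ω, ℝ) := ⟨g, hg, hgc, hgs⟩
      have e : ∫ x in Ω, v x * φ x = ∫ x in Ω, w x * φ x :=
        mul_left_cancel₀ (pow_ne_zero _ (by norm_num)) ((h₁ φ).symm.trans (h₂ φ))
      rw [← setIntegral_eq_integral_of_forall_compl_eq_zero
        (s := (Ω : Set (EuclideanSpace ℝ (Fin d))))]
      · rw [← sub_eq_zero, ← integral_sub (v.integrable_mul_test φ)
          (w.integrable_mul_test φ)] at e
        rw [← e]
        refine integral_congr_ae (Filter.Eventually.of_forall fun x => ?_)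
        change g x • (v x - w x) = v x * g x - w x * g x
        simp only [smul_eq_mul]
        ring
      · intro x hx
        have : g x = 0 := image_eq_zero_of_notMem_tsupport fun h => hx (hgs h)
        simp [this])
  refine Lp.ext ?_
  filter_upwards [(ae_restrict_iff' Ω.isOpen.measurableSet).2 key] with x hx
  exact sub_eq_zero.1 hx

end basic

/-- The set of all `u ∈ L¹(Ω)` that have a weak derivative of order `α` in `L¹(Ω)` for every
multi-index `α` with `|α| ≤ k`, as a linear subspace of `L¹(Ω)`. -/
def sobolevSubmodule {d : ℕ} (Ω : Opens (EuclideanSpace ℝ (Fin d))) (k : ℕ) :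
    Submodule ℝ (L1Space Ω) where
  carrier := {u | ∀ α ∈ multiIndices d k, ∃ v : L1Space Ω, IsWeakDeriv Ω α u v}
  zero_mem' := fun _ _ => ⟨0, .zero⟩
  add_mem' := fun h₁ h₂ α hα => by
    obtain ⟨v₁, hv₁⟩ := h₁ α hα
    obtain ⟨v₂, hv₂⟩ := h₂ α hα
    exact ⟨v₁ + v₂, hv₁.add hv₂⟩
  smul_mem' := fun c _ h₁ α hα => by
    obtain ⟨v, hv⟩ := h₁ α hα
    exact ⟨c • v, hv.smul c⟩

/-- The Sobolev space `W^{k,1}(Ω)`. It is a type of its own, since it carries the norm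
`∑_{|α| ≤ k} ‖D^α u‖_{L¹(Ω)}` and not the one inherited from `L¹(Ω)`. -/
def SobolevW1 {d : ℕ} (Ω : Opens (EuclideanSpace ℝ (Fin d))) (k : ℕ) : Type :=
  ↥(sobolevSubmodule Ω k)

namespace SobolevW1

variable {d : ℕ} {Ω : Opens (EuclideanSpace ℝ (Fin d))} {k : ℕ}

instance : AddCommGroup (SobolevW1 Ω k) :=
  inferInstanceAs (AddCommGroup ↥(sobolevSubmodule Ω k))

instance : Module ℝ (SobolevW1 Ω k) :=
  inferInstanceAs (Module ℝ ↥(sobolevSubmodule Ω k))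

/-- The inclusion of `W^{k,1}(Ω)` into `L¹(Ω)`. -/
def toL1 : SobolevW1 Ω k →ₗ[ℝ] L1Space Ω := (sobolevSubmodule Ω k).subtype

theorem toL1_injective : Function.Injective (toL1 : SobolevW1 Ω k → L1Space Ω) :=
  Subtype.val_injective

open Classical in
/-- The weak derivative `D^α u ∈ L¹(Ω)` of `u ∈ W^{k,1}(Ω)`, for `|α| ≤ k`
(and zero for a longer `α` if there is no such derivative). -/
def weakDeriv (α : Fin d → ℕ) (u : SobolevW1 Ω k) : L1Space Ω :=
  if h : ∃ v : L1Space Ω, IsWeakDeriv Ω α (toL1 u) v then h.choose else 0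

theorem isWeakDeriv_weakDeriv {α : Fin d → ℕ} (hα : α ∈ multiIndices d k) (u : SobolevW1 Ω k) :
    IsWeakDeriv Ω α (toL1 u) (weakDeriv α u) := by
  have h : ∃ v : L1Space Ω, IsWeakDeriv Ω α (toL1 u) v := u.2 α hα
  rw [weakDeriv, dif_pos h]
  exact h.choose_spec

theorem weakDeriv_eq {α : Fin d → ℕ} (hα : α ∈ multiIndices d k) {u : SobolevW1 Ω k} {v : L1Space Ω}
    (h : IsWeakDeriv Ω α (toL1 u) v) : weakDeriv α u = v :=
  (isWeakDeriv_weakDeriv hα u).unique h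

theorem weakDeriv_zero_index (u : SobolevW1 Ω k) : weakDeriv 0 u = toL1 u :=
  weakDeriv_eq (by simp [mem_multiIndices]) fun φ => by simp [testDeriv_zero]

theorem weakDeriv_add {α : Fin d → ℕ} (hα : α ∈ multiIndices d k) (u v : SobolevW1 Ω k) :
    weakDeriv α (u + v) = weakDeriv α u + weakDeriv α v :=
  weakDeriv_eq hα (by
    rw [map_add]
    exact (isWeakDeriv_weakDeriv hα u).add (isWeakDeriv_weakDeriv hα v))

theorem weakDeriv_smul {α : Fin d → ℕ} (hα : α ∈ multiIndices d k) (c : ℝ) (u : SobolevW1 Ω k) :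
    weakDeriv α (c • u) = c • weakDeriv α u :=
  weakDeriv_eq hα (by
    rw [map_smul]
    exact (isWeakDeriv_weakDeriv hα u).smul c)

/-- The norm `‖u‖ = ∑_{|α| ≤ k} ‖D^α u‖_{L¹(Ω)}` of `W^{k,1}(Ω)`. -/
instance : Norm (SobolevW1 Ω k) where
  norm u := ∑ α ∈ multiIndices d k, ‖weakDeriv α u‖

theorem norm_def (u : SobolevW1 Ω k) : ‖u‖ = ∑ α ∈ multiIndices d k, ‖weakDeriv α u‖ := rfl

theorem normCore : NormedSpace.Core ℝ (SobolevW1 Ω k) where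
  norm_nonneg u := Finset.sum_nonneg fun _ _ => norm_nonneg _
  norm_smul c u := by
    rw [norm_def, norm_def, Finset.mul_sum]
    refine Finset.sum_congr rfl fun α hα => ?_
    rw [weakDeriv_smul hα, norm_smul]
  norm_triangle u v := by
    rw [norm_def, norm_def, norm_def, ← Finset.sum_add_distrib]
    refine Finset.sum_le_sum fun α hα => ?_
    rw [weakDeriv_add hα]
    exact norm_add_le _ _
  norm_eq_zero_iff u := by
    constructor
    · intro h
      rw [norm_def, Finset.sum_eq_zero_iff_of_nonneg fun _ _ => norm_nonneg _] at h
      have h0 := norm_eq_zero.1 (h 0 (by simp [mem_multiIndices]))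
      rw [weakDeriv_zero_index] at h0
      exact toL1_injective (h0.trans (map_zero toL1).symm)
    · rintro rfl
      rw [norm_def]
      refine Finset.sum_eq_zero fun α hα => ?_
      have := weakDeriv_smul hα (0 : ℝ) (0 : SobolevW1 Ω k)
      rw [smul_zero, zero_smul] at this
      rw [this, norm_zero]

instance : NormedAddCommGroup (SobolevW1 Ω k) := NormedAddCommGroup.ofCore normCore

instance : NormedSpace ℝ (SobolevW1 Ω k) := NormedSpace.ofCore normCore

end SobolevW1

end

/-! The jet `u ↦ (D^α u)_{|α| ≤ k}` carries `W^{k,1}(Ω)` with its weak topology onto a closed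
subspace of a finite product of copies of weak `L¹(Ω)`. It is inducing because Hahn–Banach writes
every functional on `W^{k,1}` as a sum of functionals on the components. Its range is closed because
being a weak derivative is tested by integrals against bounded functions. Hence `F` is relatively
weakly compact iff each `{D^α f : f ∈ F}` is (`isCompact_closure_iff`), and the theorem reduces to
Dunford–Pettis in `L¹`, applied to finitely many components.

Sufficiency in `L¹`: cutting `f` off where it is large and outside a set `w` of finite measure costs
at most `ε` in norm. The truncations lie in the image of an `L²` ball, which is weakly compact. A
bounded set that is uniformly close to weakly compact sets is relatively weakly compact, as is seen
in the bidual.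

Necessity in `L¹`: boundedness is Banach–Steinhaus. For the rest, replace `μ` by a finite measure
`ν` with the same null sets. Smallness of `∫_A |f|` for `ν`-small `A` gives equi-integrability and
tightness at once, since both `μ`-small sets and complements of large sets of finite measure are
`ν`-small. If it failed, a weakly convergent sequence (`L¹` is separable) would contradict
Vitali–Hahn–Saks, which is a Baire category argument. -/

/-! ### Weak compactness in normed spaces. -/

section FunctionalAnalysis

open NormedSpace Filter Topology Bornology Pointwise

/-- Continuous linear functionals are weakly continuous. -/
theorem continuous_eval_weakSpace {V : Type*} [NormedAddCommGroup V] [NormedSpace ℝ V]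
    (ℓ : StrongDual ℝ V) : Continuous fun x : WeakSpace ℝ V => ℓ ((toWeakSpace ℝ V).symm x) :=
  WeakBilin.eval_continuous (topDualPairing ℝ V).flip ℓ

/-- A bounded subset of a Banach space that is, for every `ε > 0`, contained in the
`ε`-neighbourhood of a weakly compact set, is relatively weakly compact. -/
theorem isCompact_closure_toWeakSpace_of_approx {V : Type*} [NormedAddCommGroup V]
    [NormedSpace ℝ V] [CompleteSpace V] {S : Set V} (hS : IsBounded S)
    (h : ∀ ε > 0, ∃ K : Set V, IsCompact (toWeakSpace ℝ V '' K) ∧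
      ∀ f ∈ S, ∃ g ∈ K, ‖f - g‖ ≤ ε) :
    IsCompact (closure (toWeakSpace ℝ V '' S)) := by
  have hpre : toWeakSpace ℝ V ⁻¹' (toWeakSpace ℝ V '' S) = S :=
    Set.preimage_image_eq _ (toWeakSpace ℝ V).injective
  -- By Banach–Alaoglu it suffices that every point `ξ` of the weak-* closure of `S` in the bidual
  -- comes from `V`. As `V` is norm closed there, approximating `ξ` in norm by elements of `V` is
  -- enough.
  refine isCompact_closure_of_isBounded ℝ V _ (by rwa [hpre]) ?_
  intro ξ hξ
  have hclosed : IsClosed (Set.range (inclusionInDoubleDualLi ℝ (E := V))) :=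
    (inclusionInDoubleDualLi ℝ (E := V)).isometry.isUniformInducing.isComplete_range.isClosed
  suffices hmem : WeakDual.toStrongDual ξ ∈ Set.range (inclusionInDoubleDualLi ℝ (E := V)) by
    obtain ⟨x, hx⟩ := hmem
    refine ⟨toWeakSpace ℝ V x, ?_⟩
    exact WeakDual.toStrongDual.injective hx
  rw [← hclosed.closure_eq]
  refine (Metric.mem_closure_iff (α := StrongDual ℝ (StrongDual ℝ V))).2 ?_
  intro ε hε
  obtain ⟨K, hK, hKS⟩ := h (ε / 2) (half_pos hε)
  -- `K` plus a ball of the bidual is weak-* compact, hence closed, so it contains `ξ` along with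
  -- `S`.
  let C : Set (WeakDual ℝ (StrongDual ℝ V)) :=
    inclusionInDoubleDualWeak ℝ V '' (toWeakSpace ℝ V '' K) +
      WeakDual.toStrongDual ⁻¹' Metric.closedBall 0 (ε / 2)
  have hC : IsCompact C :=
    (hK.image (inclusionInDoubleDualWeak ℝ V).continuous).add (WeakDual.isCompact_closedBall 0 _)
  have hsub : inclusionInDoubleDualWeak ℝ V '' (toWeakSpace ℝ V '' S) ⊆ C := by
    rintro _ ⟨_, ⟨f, hf, rfl⟩, rfl⟩
    obtain ⟨g, hg, hfg⟩ := hKS f hf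
    refine Set.mem_add.2 ⟨inclusionInDoubleDualWeak ℝ V (toWeakSpace ℝ V g), ⟨_, ⟨g, hg, rfl⟩, rfl⟩,
      inclusionInDoubleDualWeak ℝ V (toWeakSpace ℝ V (f - g)), ?_, ?_⟩
    · exact (mem_closedBall_zero_iff (E := StrongDual ℝ (StrongDual ℝ V))).2
        ((double_dual_bound ℝ V (f - g)).trans hfg)
    · rw [← map_add, ← map_add, add_sub_cancel]
  obtain ⟨_, ⟨_, ⟨g, -, rfl⟩, rfl⟩, η, hη, hsum⟩ := closure_minimal hsub hC.isClosed hξ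
  refine ⟨_, ⟨g, rfl⟩, ?_⟩
  have hη' : ‖WeakDual.toStrongDual η‖ ≤ ε / 2 :=
    (mem_closedBall_zero_iff (E := StrongDual ℝ (StrongDual ℝ V))).1 hη
  have hξg : WeakDual.toStrongDual ξ = inclusionInDoubleDualLi ℝ g + WeakDual.toStrongDual η := by
    rw [← hsum, map_add]
    rfl
  refine (dist_eq_norm (E := StrongDual ℝ (StrongDual ℝ V)) _ _).trans_lt ?_
  rw [hξg]
  refine (congrArg norm (add_sub_cancel_left (G := StrongDual ℝ (StrongDual ℝ V)) _ _)).trans_lt ?_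
  linarith

/-- Closed balls of a Hilbert space are weakly compact. -/
theorem isCompact_toWeakSpace_closedBall {H : Type*} [NormedAddCommGroup H]
    [InnerProductSpace ℝ H] [CompleteSpace H] (r : ℝ) :
    IsCompact (toWeakSpace ℝ H '' Metric.closedBall 0 r) := by
  -- Reflexivity, by applying Riesz representation twice.
  have hsurj : Function.Surjective (inclusionInDoubleDualWeak ℝ H) := by
    intro ξ
    let ℓ : StrongDual ℝ H := (WeakDual.toStrongDual ξ).comp (innerSL ℝ)
    refine ⟨toWeakSpace ℝ H ((InnerProductSpace.toDual ℝ H).symm ℓ), ?_⟩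
    refine DFunLike.ext _ _ fun φ => ?_
    obtain ⟨y, rfl⟩ := (InnerProductSpace.toDual ℝ H).surjective φ
    change InnerProductSpace.toDual ℝ H y ((InnerProductSpace.toDual ℝ H).symm ℓ) = _
    rw [InnerProductSpace.toDual_apply_apply, real_inner_comm,
      InnerProductSpace.toDual_symm_apply]
    rfl
  have hpre : toWeakSpace ℝ H '' Metric.closedBall 0 r = inclusionInDoubleDualWeak ℝ H ⁻¹'
      (WeakDual.toStrongDual ⁻¹' Metric.closedBall 0 r) := by
    ext x
    obtain ⟨x, rfl⟩ := (toWeakSpace ℝ H).surjective x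
    rw [(toWeakSpace ℝ H).injective.mem_set_image, Set.mem_preimage, Set.mem_preimage,
      mem_closedBall_zero_iff,
      ← (inclusionInDoubleDualLi ℝ (E := H)).norm_map x]
    exact (mem_closedBall_zero_iff (E := StrongDual ℝ (StrongDual ℝ H))).symm
  rw [hpre]
  refine (isEmbedding_inclusionInDoubleDualWeak ℝ H).isInducing.isCompact_preimage'
    (WeakDual.isCompact_closedBall 0 r) ?_
  rw [hsurj.range_eq]
  exact Set.subset_univ _

/-- A relatively weakly compact set is bounded. -/
theorem isBounded_of_isCompact_closure_toWeakSpace {V : Type*} [NormedAddCommGroup V]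
    [NormedSpace ℝ V] {S : Set V} (h : IsCompact (closure (toWeakSpace ℝ V '' S))) :
    IsBounded S := by
  -- Elements of `S` are regarded as functionals on the dual, which is complete even if `V` is not.
  have hb : ∀ ℓ : StrongDual ℝ V, ∃ C, ∀ f : S, ‖inclusionInDoubleDual ℝ V f ℓ‖ ≤ C := by
    intro ℓ
    obtain ⟨C, hC⟩ := (h.image (continuous_eval_weakSpace ℓ)).isBounded.exists_norm_le
    exact ⟨C, fun f => hC _ ⟨_, subset_closure ⟨f, f.2, rfl⟩, by simp⟩⟩
  obtain ⟨C, hC⟩ := banach_steinhaus hb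
  refine isBounded_iff_forall_norm_le.2 ⟨C, fun f hf => ?_⟩
  rw [← (inclusionInDoubleDualLi ℝ (E := V)).norm_map f]
  exact hC ⟨f, hf⟩

/-- A weakly compact subset of a separable normed space is weakly sequentially compact. -/
theorem IsCompact.isSeqCompact_weakSpace {V : Type*} [NormedAddCommGroup V]
    [NormedSpace ℝ V] [SeparableSpace V] {K : Set (WeakSpace ℝ V)} (hK : IsCompact K) :
    IsSeqCompact K := by
  -- Norming functionals of a dense sequence separate points. Countably many weakly continuous
  -- functions thus separate the points of `K`, and the compact space `K` is metrizable.
  choose ℓ hℓ hℓx using fun n => exists_dual_vector'' ℝ (denseSeq V n)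
  have hsep : ∀ x : V, (∀ n, ℓ n x = 0) → x = 0 := by
    intro x hx
    rw [← norm_le_zero_iff]
    refine le_of_forall_pos_le_add fun ε hε => ?_
    obtain ⟨n, hn⟩ := (denseRange_denseSeq V).exists_dist_lt x (half_pos hε)
    have h1 : ‖denseSeq V n‖ ≤ ‖denseSeq V n - x‖ := by
      have h2 : ℓ n (denseSeq V n - x) = ‖denseSeq V n‖ := by rw [map_sub, hx, hℓx]; simp
      calc ‖denseSeq V n‖ ≤ ‖ℓ n (denseSeq V n - x)‖ := by rw [h2]; exact le_abs_self _
        _ ≤ 1 * ‖denseSeq V n - x‖ := (ℓ n).le_of_opNorm_le (hℓ n) _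
        _ = _ := one_mul _
    rw [dist_eq_norm, norm_sub_rev] at hn
    have h3 := norm_sub_norm_le x (denseSeq V n)
    rw [norm_sub_rev] at h3
    linarith
  have : CompactSpace K := isCompact_iff_compactSpace.mp hK
  have : MetrizableSpace K :=
    Metric.PiNatEmbed.TopologicalSpace.MetrizableSpace.of_countable_separating
      (fun n (x : K) => ℓ n ((toWeakSpace ℝ V).symm x))
      (fun n => (continuous_eval_weakSpace (ℓ n)).comp continuous_subtype_val) (by
        intro x y hxy
        by_contra! hcon
        refine hxy (Subtype.ext ((toWeakSpace ℝ V).symm.injective (sub_eq_zero.1 (hsep _ ?_))))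
        intro n
        rw [map_sub, sub_eq_zero]
        exact hcon n)
  have hseq : SeqContinuous (fun x : K => (x : WeakSpace ℝ V)) :=
    continuous_iff_seqContinuous.mp continuous_subtype_val
  simpa using IsSeqCompact.range hseq

end FunctionalAnalysis

/-! ### Dunford–Pettis: bounded, equi-integrable and tight sets. -/

section DunfordPettisSufficiency

open Filter Topology Bornology

variable {X : Type*} [MeasurableSpace X] {μ : Measure X}

/-- Multiplication by the indicator function of a set of finite measure, from `L²` to `L¹`. -/
theorem exists_clm_indicator_mul {w : Set X} (hw : MeasurableSet w) (hμw : μ w ≠ ⊤) :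
    ∃ T : Lp ℝ 2 μ →L[ℝ] Lp ℝ 1 μ, ∀ h : Lp ℝ 2 μ, T h =ᵐ[μ] w.indicator h := by
  refine ⟨(ContinuousLinearMap.mul ℝ ℝ).holderL μ 2 2 1 (indicatorConstLp 2 hw hμw 1), fun h => ?_⟩
  filter_upwards [(ContinuousLinearMap.mul ℝ ℝ).coeFn_holder (r := 1)
    (indicatorConstLp 2 hw hμw (1 : ℝ)) h,
    indicatorConstLp_coeFn (p := 2) (hs := hw) (hμs := hμw) (c := (1 : ℝ))] with x h1 h2
  refine h1.trans ?_
  rw [h2, ContinuousLinearMap.mul_apply']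
  by_cases hx : x ∈ w <;> simp [hx]

/-- Sufficiency in the Dunford–Pettis theorem: a bounded, equi-integrable and tight set of
integrable functions is relatively weakly compact in `L¹`. -/
theorem isCompact_closure_toWeakSpace_L1 {S : Set (Lp ℝ 1 μ)} (hS : IsBounded S)
    (hδ : ∀ ε > 0, ∃ δ > 0, ∀ f ∈ S, ∀ A, MeasurableSet A → μ A < ENNReal.ofReal δ →
      ∫ x in A, ‖f x‖ ∂μ < ε)
    (hω : ∀ ε > 0, ∃ w, MeasurableSet w ∧ μ w ≠ ⊤ ∧ ∀ f ∈ S, ∫ x in wᶜ, ‖f x‖ ∂μ < ε) :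
    IsCompact (closure (toWeakSpace ℝ (Lp ℝ 1 μ) '' S)) := by
  refine isCompact_closure_toWeakSpace_of_approx hS fun ε hε => ?_
  obtain ⟨M, hM, hSM⟩ := hS.exists_pos_norm_le
  obtain ⟨δ, hδ0, hδS⟩ := hδ (ε / 2) (half_pos hε)
  obtain ⟨w, hw, hμw, hwS⟩ := hω (ε / 2) (half_pos hε)
  obtain ⟨T, hT⟩ := exists_clm_indicator_mul hw hμw
  -- With this level Chebyshev gives `μ {C ≤ ‖f‖} ≤ M / C = δ / 2 < δ`.
  set C : ℝ := 2 * M / δ with hC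
  have hC0 : 0 < C := by positivity
  -- The approximant is `f` restricted to `w ∩ Bᶜ`, where `B = {C ≤ ‖f‖}`. It is dominated by `C`
  -- times the indicator of `w`, whence the radius.
  refine ⟨T '' Metric.closedBall 0 (C * ‖indicatorConstLp 2 hw hμw (1 : ℝ)‖), ?_, fun f hf => ?_⟩
  · have := (isCompact_toWeakSpace_closedBall (H := Lp ℝ 2 μ)
      (C * ‖indicatorConstLp 2 hw hμw (1 : ℝ)‖)).image (WeakSpace.map T).continuous
    rw [Set.image_image] at this ⊢
    exact this
  have hfm : StronglyMeasurable f := Lp.stronglyMeasurable f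
  have hfi : Integrable f μ := L1.integrable_coeFn f
  set B : Set X := {x | C ≤ ‖f x‖} with hB
  have hBm : MeasurableSet B := measurableSet_le measurable_const hfm.norm.measurable
  have hBμ : μ B < ENNReal.ofReal δ := by
    have h1 := mul_meas_ge_le_integral_of_nonneg (μ := μ) (f := fun x => ‖f x‖)
      (Eventually.of_forall fun x => norm_nonneg _) hfi.norm C
    rw [← L1.norm_eq_integral_norm] at h1
    have h2 : μ B ≠ ⊤ := (hfi.norm.measure_ge_lt_top hC0).ne
    rw [ENNReal.lt_ofReal_iff_toReal_lt h2]
    have h3 : C * μ.real B ≤ M := h1.trans (hSM f hf)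
    have h4 : μ.real B ≤ M / C := by rwa [le_div_iff₀' hC0]
    have h5 : M / C = δ / 2 := by rw [hC]; field_simp
    have h6 : μ.real B < δ := by linarith
    exact h6
  have hbound : ∀ x, ‖(w ∩ Bᶜ).indicator f x‖ ≤ w.indicator (fun _ => C) x := by
    intro x
    by_cases hxw : x ∈ w
    · by_cases hxB : x ∈ B
      · simp [hxw, hxB, hC0.le]
      · simp only [Set.mem_inter_iff, hxw, Set.mem_compl_iff, hxB, not_false_eq_true, and_self,
          Set.indicator_of_mem]
        exact (not_le.1 hxB).le
    · simp [hxw]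
  have hmem : MemLp ((w ∩ Bᶜ).indicator f) 2 μ :=
    (memLp_indicator_const 2 hw C (Or.inr hμw)).mono'
      (hfm.indicator (hw.inter hBm.compl)).aestronglyMeasurable (Eventually.of_forall hbound)
  refine ⟨T hmem.toLp, ⟨hmem.toLp, ?_, rfl⟩, ?_⟩
  · rw [mem_closedBall_zero_iff]
    refine Lp.norm_le_mul_norm_of_ae_le_mul ?_
    filter_upwards [hmem.coeFn_toLp,
      indicatorConstLp_coeFn (p := 2) (hs := hw) (hμs := hμw) (c := (1 : ℝ))] with x h1 h2
    rw [h1, h2]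
    refine (hbound x).trans ?_
    by_cases hxw : x ∈ w <;> simp [hxw]
  -- The error lives on `wᶜ ∪ B`; tightness and equi-integrability bound the two parts by `ε / 2`
  -- each.
  · have hae : ∀ᵐ x ∂μ, ‖(f - T hmem.toLp : Lp ℝ 1 μ) x‖ ≤
        wᶜ.indicator (fun x => ‖f x‖) x + B.indicator (fun x => ‖f x‖) x := by
      filter_upwards [Lp.coeFn_sub f (T hmem.toLp), hT hmem.toLp, hmem.coeFn_toLp] with x h1 h2 h3
      rw [h1, Pi.sub_apply, h2]
      by_cases hxw : x ∈ w
      · rw [Set.indicator_of_mem hxw, h3]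
        by_cases hxB : x ∈ B <;> simp [hxw, hxB]
      · by_cases hxB : x ∈ B <;> simp [hxw, hxB]
    have hi1 : Integrable (wᶜ.indicator fun x => ‖f x‖) μ := hfi.norm.indicator hw.compl
    have hi2 : Integrable (B.indicator fun x => ‖f x‖) μ := hfi.norm.indicator hBm
    rw [L1.norm_eq_integral_norm]
    refine (integral_mono_ae (L1.integrable_coeFn _).norm (hi1.add hi2) hae).trans ?_
    rw [integral_add' hi1 hi2, integral_indicator hw.compl, integral_indicator hBm]
    linarith [hδS f hf B hBm hBμ, hwS f hf]

end DunfordPettisSufficiency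

/-! ### Dunford–Pettis: Vitali–Hahn–Saks, equi-integrability and tightness. -/

section DunfordPettisNecessity

open Filter Topology Bornology

variable {X : Type*} [MeasurableSpace X] {μ : Measure X}

/-- A finite measure that is absolutely continuous with respect to a σ-finite one is so in the
`ε`-`δ` sense. -/
theorem exists_pos_measure_lt_of_absolutelyContinuous {τ ν : Measure X} [IsFiniteMeasure τ]
    [SigmaFinite ν] (h : τ ≪ ν) {ε : ENNReal} (hε : ε ≠ 0) :
    ∃ δ > 0, ∀ A, ν A < δ → τ A < ε := by
  obtain ⟨δ, hδ, hA⟩ := exists_pos_setLIntegral_lt_of_measure_lt (μ := ν) (f := τ.rnDeriv ν)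
    (by rw [Measure.lintegral_rnDeriv h]; exact measure_ne_top _ _) hε
  refine ⟨δ, hδ, fun A hνA => ?_⟩
  rw [← Measure.setLIntegral_rnDeriv h]
  exact hA A hνA

/-- The integral of an integrable function is absolutely continuous with respect to any
σ-finite measure that dominates the given one. -/
theorem exists_pos_setIntegral_norm_lt {ν : Measure X} [SigmaFinite ν] (h : μ ≪ ν)
    {f : X → ℝ} (hf : Integrable f μ) {ε : ℝ} (hε : 0 < ε) :
    ∃ δ > 0, ∀ A, MeasurableSet A → ν A < δ → ∫ x in A, ‖f x‖ ∂μ < ε := by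
  have : IsFiniteMeasure (μ.withDensity fun x => ‖f x‖ₑ) :=
    isFiniteMeasure_withDensity hf.hasFiniteIntegral.ne
  obtain ⟨δ, hδ, hA⟩ := exists_pos_measure_lt_of_absolutelyContinuous
    ((withDensity_absolutelyContinuous μ fun x => ‖f x‖ₑ).trans h)
    (ENNReal.ofReal_pos.2 hε).ne'
  refine ⟨δ, hδ, fun A hAm hνA => ?_⟩
  have h1 := hA A hνA
  rw [withDensity_apply _ hAm] at h1
  rw [integral_norm_eq_lintegral_enorm hf.aestronglyMeasurable.restrict]
  exact (ENNReal.lt_ofReal_iff_toReal_lt h1.ne_top).1 h1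

/-- Integration against a bounded function is a continuous linear functional on `L¹`. -/
theorem exists_clm_integral_mul {g : X → ℝ} (hg : AEStronglyMeasurable g μ) {C : ℝ}
    (hC : ∀ᵐ x ∂μ, ‖g x‖ ≤ C) :
    ∃ ℓ : StrongDual ℝ (Lp ℝ 1 μ), ∀ f : Lp ℝ 1 μ, ℓ f = ∫ x, f x * g x ∂μ := by
  have hint : ∀ f : Lp ℝ 1 μ, Integrable (fun x => f x * g x) μ := fun f =>
    (L1.integrable_coeFn f).mul_bdd hg hC
  let T : Lp ℝ 1 μ →ₗ[ℝ] ℝ :=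
    { toFun := fun f => ∫ x, f x * g x ∂μ
      map_add' := fun f₁ f₂ => by
        rw [← integral_add (hint f₁) (hint f₂)]
        refine integral_congr_ae ?_
        filter_upwards [Lp.coeFn_add f₁ f₂] with x hx
        rw [hx, Pi.add_apply, add_mul]
      map_smul' := fun c f => by
        rw [RingHom.id_apply, smul_eq_mul, ← integral_const_mul]
        refine integral_congr_ae ?_
        filter_upwards [Lp.coeFn_smul c f] with x hx
        rw [hx, Pi.smul_apply, smul_eq_mul, mul_assoc] }
  refine ⟨T.mkContinuous C fun f => ?_, fun f => rfl⟩
  rw [L1.norm_eq_integral_norm, ← integral_const_mul]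
  refine norm_integral_le_of_norm_le ((L1.integrable_coeFn f).norm.const_mul C) ?_
  filter_upwards [hC] with x hx
  rw [norm_mul, mul_comm]
  exact mul_le_mul_of_nonneg_right hx (norm_nonneg _)

/-- On the unit ball of `L^∞` with the topology of `L¹(ν)`, integration against a `μ`-integrable
function is continuous if `μ ≪ ν`. -/
theorem continuous_integral_mul_of_ae_bound {ν : Measure X} (h : μ ≪ ν) {f : X → ℝ}
    (hf : Integrable f μ) :
    Continuous fun g : {g : Lp ℝ 1 ν // ∀ᵐ x ∂ν, ‖g x‖ ≤ 1} => ∫ x, f x * g.1 x ∂μ := by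
  refine continuous_iff_seqContinuous.2 fun g g₀ hg => ?_
  -- Every subsequence has a further one converging a.e., to which dominated convergence applies.
  refine tendsto_of_subseq_tendsto fun ns hns => ?_
  have hg' : Tendsto (fun n => (g (ns n)).1) atTop (𝓝 g₀.1) :=
    (continuous_subtype_val.tendsto _).comp (hg.comp hns)
  obtain ⟨ms, -, hms⟩ := (tendstoInMeasure_of_tendsto_Lp hg').exists_seq_tendsto_ae
  refine ⟨ms, tendsto_integral_of_dominated_convergence (fun x => ‖f x‖) ?_ hf.norm ?_ ?_⟩
  · exact fun n => hf.aestronglyMeasurable.mul (Lp.stronglyMeasurable _).aestronglyMeasurable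
  · intro n
    filter_upwards [h.ae_le (g (ns (ms n))).2] with x hx
    rw [norm_mul]
    exact mul_le_of_le_one_right (norm_nonneg _) hx
  · filter_upwards [h.ae_le hms] with x hx
    exact hx.const_mul _

/-- Gives completeness of the ball, as Baire's theorem requires. The bound survives in the limit
along an a.e. convergent subsequence. -/
theorem isClosed_ae_norm_le_one (ν : Measure X) :
    IsClosed {g : Lp ℝ 1 ν | ∀ᵐ x ∂ν, ‖g x‖ ≤ 1} := by
  refine IsSeqClosed.isClosed fun g g₀ hg hlim => ?_
  obtain ⟨ms, -, hms⟩ := (tendstoInMeasure_of_tendsto_Lp hlim).exists_seq_tendsto_ae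
  filter_upwards [hms, ae_all_iff.2 hg] with x hx hb
  exact le_of_tendsto' hx.norm fun n => hb _

/-- Modifying an element of `L¹(ν)` on a set of small measure, within the unit ball of `L^∞`. -/
theorem exists_piecewise_near {ν : Measure X} [IsFiniteMeasure ν] {g : Lp ℝ 1 ν}
    (hg : ∀ᵐ x ∂ν, ‖g x‖ ≤ 1) {s : X → ℝ} (hs : Measurable s) (hs1 : ∀ x, ‖s x‖ ≤ 1)
    {A : Set X} (hA : MeasurableSet A) :
    ∃ g' : Lp ℝ 1 ν, (∀ᵐ x ∂ν, ‖g' x‖ ≤ 1) ∧ dist g' g ≤ 2 * ν.real A ∧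
      (∀ᵐ x ∂ν, x ∈ A → g' x = s x) ∧ ∀ᵐ x ∂ν, x ∉ A → g' x = g x := by
  classical
  have hm : Measurable (A.piecewise s g) := hs.piecewise hA (Lp.stronglyMeasurable g).measurable
  have hb : ∀ᵐ x ∂ν, ‖A.piecewise s g x‖ ≤ 1 := by
    filter_upwards [hg] with x hx
    by_cases hxA : x ∈ A
    · rw [Set.piecewise_eq_of_mem _ _ _ hxA]
      exact hs1 x
    · rwa [Set.piecewise_eq_of_notMem _ _ _ hxA]
  have hL : MemLp (A.piecewise s g) 1 ν := MemLp.of_bound hm.aestronglyMeasurable 1 hb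
  refine ⟨hL.toLp, ?_, ?_, ?_, ?_⟩
  · filter_upwards [hL.coeFn_toLp, hb] with x h1 h2
    rwa [h1]
  · rw [dist_eq_norm, L1.norm_eq_integral_norm]
    have hi : Integrable (A.indicator fun _ => (2 : ℝ)) ν :=
      (integrable_const _).indicator hA
    refine (integral_mono_ae (g := A.indicator fun _ => (2 : ℝ))
      (L1.integrable_coeFn _).norm hi ?_).trans ?_
    · filter_upwards [Lp.coeFn_sub hL.toLp g, hL.coeFn_toLp, hg] with x h1 h2 h3
      rw [h1, Pi.sub_apply, h2]
      by_cases hxA : x ∈ A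
      · simp only [hxA, Set.piecewise_eq_of_mem, Set.indicator_of_mem]
        exact (norm_sub_le _ _).trans (by linarith [hs1 x])
      · simp [hxA]
    · rw [integral_indicator hA, setIntegral_const, smul_eq_mul, mul_comm]
  · filter_upwards [hL.coeFn_toLp] with x h1 hxA
    rw [h1, Set.piecewise_eq_of_mem _ _ _ hxA]
  · filter_upwards [hL.coeFn_toLp] with x h1 hxA
    rw [h1, Set.piecewise_eq_of_notMem _ _ _ hxA]

/-- **Vitali–Hahn–Saks**: if the integrals of a sequence of integrable functions against every
bounded function converge, then the sequence is equi-integrable. -/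
theorem exists_pos_forall_setIntegral_norm_lt_of_cauchySeq {ν : Measure X} [IsFiniteMeasure ν]
    (hμν : μ ≪ ν) (f : ℕ → Lp ℝ 1 μ)
    (hf : ∀ g : X → ℝ, Measurable g → (∀ᵐ x ∂μ, ‖g x‖ ≤ 1) →
      CauchySeq fun n => ∫ x, f n x * g x ∂μ) {ε : ℝ} (hε : 0 < ε) :
    ∃ δ > 0, ∀ n, ∀ A, MeasurableSet A → ν A < δ → ∫ x in A, ‖f n x‖ ∂μ < ε := by
  let B := {g : Lp ℝ 1 ν // ∀ᵐ x ∂ν, ‖g x‖ ≤ 1}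
  have : CompleteSpace B := (isClosed_ae_norm_le_one ν).completeSpace_coe
  have : Nonempty B := ⟨⟨0, by
    filter_upwards [Lp.coeFn_zero ℝ 1 ν] with x hx
    rw [hx, Pi.zero_apply, norm_zero]
    exact zero_le_one⟩⟩
  have hfi : ∀ n, Integrable (f n) μ := fun n => L1.integrable_coeFn (f n)
  have hmul : ∀ n (g : B), Integrable (fun x => f n x * g.1 x) μ := fun n g =>
    (hfi n).mul_bdd (Lp.stronglyMeasurable g.1).aestronglyMeasurable (hμν.ae_le g.2)
  -- These closed sets cover `B` by the Cauchy hypothesis, so one of them contains a ball. The final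
  -- bound is `ε/8 + ε/8` for `f n - f N` plus `ε/2` for `f N`.
  let T : ℕ → Set B := fun N => {g | ∀ n ≥ N,
    dist (∫ x, f n x * g.1 x ∂μ) (∫ x, f N x * g.1 x ∂μ) ≤ ε / 8}
  have hTc : ∀ N, IsClosed (T N) := by
    intro N
    simp only [T, Set.ofPred_forall]
    exact isClosed_iInter fun n => isClosed_iInter fun _ => isClosed_le
      ((continuous_integral_mul_of_ae_bound hμν (hfi n)).dist
        (continuous_integral_mul_of_ae_bound hμν (hfi N))) continuous_const
  have hTu : ⋃ N, T N = Set.univ := by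
    refine Set.eq_univ_of_forall fun g => Set.mem_iUnion.2 ?_
    obtain ⟨N, hN⟩ := Metric.cauchySeq_iff'.1
      (hf g.1 (Lp.stronglyMeasurable g.1).measurable (hμν.ae_le g.2)) (ε / 8) (by positivity)
    exact ⟨N, fun n hn => (hN n hn).le⟩
  obtain ⟨N, g₀, hg₀⟩ := nonempty_interior_of_iUnion_of_closed hTc hTu
  obtain ⟨r, hr, hball⟩ := Metric.isOpen_iff.1 isOpen_interior g₀ hg₀
  have htail : ∀ n ≥ N, ∀ A, MeasurableSet A → ν A < ENNReal.ofReal (r / 2) →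
      ∫ x in A, ‖f n x - f N x‖ ∂μ ≤ ε / 4 := by
    intro n hn A hA hνA
    have hνA' : 2 * ν.real A < r := by
      have := (ENNReal.lt_ofReal_iff_toReal_lt hνA.ne_top).1 hνA
      have h' : ν.real A < r / 2 := this
      linarith
    have hhm : Measurable fun x => f n x - f N x :=
      (Lp.stronglyMeasurable (f n)).measurable.sub (Lp.stronglyMeasurable (f N)).measurable
    -- Inside the ball, `g₀` is altered on `A` to the sign of `f n - f N` (with `0 / 0 = 0`), and
    -- for `g₂` to zero. Pairing `f n - f N` with `g₁ - g₂` leaves exactly the integral of `‖f n - f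
    -- N‖` over `A`.
    obtain ⟨g₁, h1, hd1, hA1, hAc1⟩ := exists_piecewise_near g₀.2
      (s := fun x => (f n x - f N x) / ‖f n x - f N x‖) (hhm.div hhm.norm)
      (fun x => by rw [norm_div, norm_norm]; exact div_self_le_one _) hA
    obtain ⟨g₂, h2, hd2, hA2, hAc2⟩ := exists_piecewise_near g₀.2
      (s := fun _ => 0) measurable_const (fun x => by simp) hA
    have e1 := interior_subset (hball (show (⟨g₁, h1⟩ : B) ∈ Metric.ball g₀ r from
      hd1.trans_lt hνA')) n hn
    have e2 := interior_subset (hball (show (⟨g₂, h2⟩ : B) ∈ Metric.ball g₀ r from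
      hd2.trans_lt hνA')) n hn
    have heq : ∫ x in A, ‖f n x - f N x‖ ∂μ =
        ((∫ x, f n x * g₁ x ∂μ) - ∫ x, f N x * g₁ x ∂μ) -
          ((∫ x, f n x * g₂ x ∂μ) - ∫ x, f N x * g₂ x ∂μ) := by
      rw [← integral_sub (hmul n ⟨g₁, h1⟩) (hmul N ⟨g₁, h1⟩),
        ← integral_sub (hmul n ⟨g₂, h2⟩) (hmul N ⟨g₂, h2⟩),
        ← integral_indicator hA]
      refine Eq.trans ?_ (integral_sub ((hmul n ⟨g₁, h1⟩).sub (hmul N ⟨g₁, h1⟩))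
          ((hmul n ⟨g₂, h2⟩).sub (hmul N ⟨g₂, h2⟩)))
      refine integral_congr_ae ?_
      filter_upwards [hμν.ae_le hA1, hμν.ae_le hA2, hμν.ae_le hAc1, hμν.ae_le hAc2]
        with x p1 p2 q1 q2
      by_cases hxA : x ∈ A
      · rw [Set.indicator_of_mem hxA, p1 hxA, p2 hxA]
        rcases eq_or_ne (f n x - f N x) 0 with h0 | h0
        · simp [h0]
        · have h0' : ‖f n x - f N x‖ ≠ 0 := norm_ne_zero_iff.2 h0
          have hsq : ‖f n x - f N x‖ * ‖f n x - f N x‖ = (f n x - f N x) * (f n x - f N x) :=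
            abs_mul_abs_self _
          field_simp
          linear_combination hsq
      · rw [Set.indicator_of_notMem hxA, q1 hxA, q2 hxA]
        ring
    rw [heq]
    rw [Real.dist_eq] at e1 e2
    linarith [(abs_le.1 e1).2, (abs_le.1 e2).1]
  -- The finitely many indices `n ≤ N` are handled individually by absolute continuity of the
  -- integral.
  choose δ hδ hδA using fun n => exists_pos_setIntegral_norm_lt hμν (hfi n) (half_pos hε)
  obtain ⟨δ₀, hδ₀, hmin⟩ : ∃ δ₀ > 0, ∀ n ≤ N, δ₀ ≤ δ n := by
    refine ⟨(Finset.range (N + 1)).inf δ, ?_, fun n hn => Finset.inf_le (by simp; omega)⟩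
    exact (Finset.lt_inf_iff ENNReal.zero_lt_top).2 fun n _ => hδ n
  refine ⟨min δ₀ (ENNReal.ofReal (r / 2)), lt_min hδ₀ (ENNReal.ofReal_pos.2 (half_pos hr)),
    fun n A hA hνA => ?_⟩
  have hνA1 := hνA.trans_le (min_le_left _ _)
  rcases le_total n N with hn | hn
  · linarith [hδA n A hA (hνA1.trans_le (hmin n hn))]
  · have h1 := htail n hn A hA (hνA.trans_le (min_le_right _ _))
    have h2 := hδA N A hA (hνA1.trans_le (hmin N le_rfl))
    have h3 : ∫ x in A, ‖f n x‖ ∂μ ≤ ∫ x in A, (‖f n x - f N x‖ + ‖f N x‖) ∂μ := by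
      refine integral_mono (hfi n).norm.restrict
        (((hfi n).sub (hfi N)).norm.add (hfi N).norm).restrict fun x => ?_
      simpa using norm_add_le (f n x - f N x) (f N x)
    have h4 := integral_add (μ := μ.restrict A) ((hfi n).sub (hfi N)).norm.restrict
      (hfi N).norm.restrict
    simp only [Pi.sub_apply] at h4
    linarith

/-- A relatively weakly compact set in `L¹` is equi-integrable with respect to a finite measure
that dominates the given one. -/
theorem exists_pos_forall_setIntegral_norm_lt_of_isCompact [IsSeparable μ] {ν : Measure X}
    [IsFiniteMeasure ν] (hμν : μ ≪ ν) {S : Set (Lp ℝ 1 μ)}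
    (hS : IsCompact (closure (toWeakSpace ℝ (Lp ℝ 1 μ) '' S))) {ε : ℝ} (hε : 0 < ε) :
    ∃ δ > 0, ∀ f ∈ S, ∀ A, MeasurableSet A → ν A < δ → ∫ x in A, ‖f x‖ ∂μ < ε := by
  by_contra! hcon
  have hpos : ∀ n : ℕ, (0 : ENNReal) < ((n : ENNReal) + 1)⁻¹ := fun n => by
    rw [ENNReal.inv_pos]
    finiteness
  choose f hfS A hA hνA hfA using fun n => hcon _ (hpos n)
  -- Serves the separability of `L¹`, through which weak compactness yields a weakly convergent
  -- subsequence.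
  have : Fact ((1 : ENNReal) ≠ ⊤) := ⟨ENNReal.one_ne_top⟩
  obtain ⟨f₀, -, φ, hφ, hlim⟩ := hS.isSeqCompact_weakSpace
    (x := fun n => toWeakSpace ℝ (Lp ℝ 1 μ) (f n)) fun n => subset_closure ⟨_, hfS n, rfl⟩
  obtain ⟨δ, hδ, hδA⟩ := exists_pos_forall_setIntegral_norm_lt_of_cauchySeq hμν
    (fun n => f (φ n)) (fun g hg hg1 => by
      obtain ⟨ℓ, hℓ⟩ := exists_clm_integral_mul hg.aestronglyMeasurable hg1
      have := ((continuous_eval_weakSpace ℓ).tendsto f₀).comp hlim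
      refine (Tendsto.congr (fun n => ?_) this).cauchySeq
      exact hℓ (f (φ n))) hε
  obtain ⟨n, hn⟩ := ENNReal.exists_inv_nat_lt hδ.ne'
  refine (hfA (φ n)).not_gt (hδA n _ (hA _) ((hνA _).trans_le (le_trans ?_ hn.le)))
  rw [ENNReal.inv_le_inv]
  exact_mod_cast (hφ.id_le n).trans (Nat.le_succ _)

/-- Necessity in the Dunford–Pettis theorem: a relatively weakly compact set in `L¹` is
equi-integrable. -/
theorem exists_pos_forall_setIntegral_norm_lt [IsSeparable μ] [SigmaFinite μ]
    {S : Set (Lp ℝ 1 μ)} (hS : IsCompact (closure (toWeakSpace ℝ (Lp ℝ 1 μ) '' S)))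
    {ε : ℝ} (hε : 0 < ε) :
    ∃ δ > 0, ∀ f ∈ S, ∀ A, NullMeasurableSet A μ → μ A < ENNReal.ofReal δ →
      ∫ x in A, ‖f x‖ ∂μ < ε := by
  obtain ⟨δ, hδ, hδA⟩ := exists_pos_forall_setIntegral_norm_lt_of_isCompact
    (absolutelyContinuous_toFinite μ) hS hε
  -- `μ.toFinite` is finite and dominated by `μ`, so `μ`-small sets are `μ.toFinite`-small.
  obtain ⟨η, hη, hηA⟩ := exists_pos_measure_lt_of_absolutelyContinuous
    (toFinite_absolutelyContinuous μ) hδ.ne'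
  obtain ⟨η', hη', hηη'⟩ := ENNReal.lt_iff_exists_real_btwn.1 hη
  refine ⟨η', ENNReal.ofReal_pos.1 hηη'.1, fun f hf A hA hμA => ?_⟩
  obtain ⟨A', -, hA'm, hAA'⟩ := hA.exists_measurable_superset_ae_eq
  rw [← setIntegral_congr_set hAA']
  refine hδA f hf A' hA'm (hηA A' ?_)
  rw [measure_congr hAA']
  exact hμA.trans hηη'.2

/-- Necessity in the Dunford–Pettis theorem: a relatively weakly compact set in `L¹` is
tight. -/
theorem exists_forall_setIntegral_compl_norm_lt [IsSeparable μ] [SigmaFinite μ]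
    {S : Set (Lp ℝ 1 μ)} (hS : IsCompact (closure (toWeakSpace ℝ (Lp ℝ 1 μ) '' S)))
    {ε : ℝ} (hε : 0 < ε) :
    ∃ w, MeasurableSet w ∧ μ w < ⊤ ∧ ∀ f ∈ S, ∫ x in wᶜ, ‖f x‖ ∂μ < ε := by
  obtain ⟨δ, hδ, hδA⟩ := exists_pos_forall_setIntegral_norm_lt_of_isCompact
    (absolutelyContinuous_toFinite μ) hS hε
  -- The complements decrease to the empty set. Their `μ`-measure may stay infinite, but the finite
  -- measure `μ.toFinite` tends to zero on them.
  have hlim : Tendsto (fun n => μ.toFinite (spanningSets μ n)ᶜ) atTop (𝓝 0) := by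
    have hanti : Antitone fun n => (spanningSets μ n)ᶜ := fun m n hmn =>
      Set.compl_subset_compl.2 (monotone_spanningSets μ hmn)
    have := tendsto_measure_iInter_atTop (μ := μ.toFinite)
      (fun n => (measurableSet_spanningSets μ n).compl.nullMeasurableSet) hanti
      ⟨0, measure_ne_top _ _⟩
    rwa [← Set.compl_iUnion, iUnion_spanningSets, Set.compl_univ, measure_empty] at this
  obtain ⟨n, hn⟩ := (hlim.eventually_lt_const hδ).exists
  exact ⟨spanningSets μ n, measurableSet_spanningSets μ n, measure_spanningSets_lt_top μ n,
    fun f hf => hδA f hf _ (measurableSet_spanningSets μ n).compl hn⟩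

end DunfordPettisNecessity

/-! ### The jet embedding and reduction to `L¹`. -/

namespace SobolevW1

open Filter Topology Bornology

variable {d : ℕ} {Ω : Opens (EuclideanSpace ℝ (Fin d))} {k : ℕ}

theorem norm_weakDeriv_le {α : Fin d → ℕ} (hα : α ∈ multiIndices d k) (u : SobolevW1 Ω k) :
    ‖weakDeriv α u‖ ≤ ‖u‖ :=
  Finset.single_le_sum (f := fun α => ‖weakDeriv α u‖) (fun _ _ => norm_nonneg _) hα

/-- The weak derivative of order `α`, as a continuous linear map from `W^{k,1}` to `L¹`. -/
noncomputable def weakDerivL (α : multiIndices d k) : SobolevW1 Ω k →L[ℝ] L1Space Ω :=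
  LinearMap.mkContinuous
    { toFun := weakDeriv α
      map_add' := weakDeriv_add α.2
      map_smul' := weakDeriv_smul α.2 } 1
    fun u => (norm_weakDeriv_le α.2 u).trans_eq (one_mul _).symm

theorem norm_eq_sum_weakDerivL (u : SobolevW1 Ω k) :
    ‖u‖ = ∑ α : multiIndices d k, ‖weakDerivL α u‖ :=
  (norm_def u).trans (Finset.sum_coe_sort _ fun α => ‖weakDeriv α u‖).symm

/-- Every continuous linear functional on `W^{k,1}` is of the form `u ↦ ∑_α c_α (D^α u)` with
continuous linear functionals `c_α` on `L¹`. -/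
theorem exists_dual_eq_sum (ℓ : StrongDual ℝ (SobolevW1 Ω k)) :
    ∃ c : multiIndices d k → StrongDual ℝ (L1Space Ω), ∀ u, ℓ u = ∑ α, c α (weakDerivL α u) := by
  let J : SobolevW1 Ω k →L[ℝ] (multiIndices d k → L1Space Ω) :=
    ContinuousLinearMap.pi weakDerivL
  have hnorm : ∀ u, ‖u‖ ≤ Fintype.card (multiIndices d k) * ‖J u‖ := by
    intro u
    rw [norm_eq_sum_weakDerivL]
    refine (Finset.sum_le_card_nsmul _ _ ‖J u‖ fun α _ => norm_le_pi_norm (J u) α).trans_eq ?_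
    rw [nsmul_eq_mul, Finset.card_univ]
  have hinj : Function.Injective J := by
    refine (injective_iff_map_eq_zero J).2 fun u hu => ?_
    have := hnorm u
    rw [hu, norm_zero, mul_zero] at this
    exact norm_le_zero_iff.1 this
  let e := LinearEquiv.ofInjective J.toLinearMap hinj
  -- `ℓ` transported to the range of the jet. It is bounded there by `hnorm`, so Hahn–Banach extends
  -- it to the product, where it splits into components.
  let g : StrongDual ℝ (LinearMap.range J.toLinearMap) :=
    LinearMap.mkContinuous ((ℓ : SobolevW1 Ω k →ₗ[ℝ] ℝ) ∘ₗ (e.symm : _ →ₗ[ℝ] SobolevW1 Ω k))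
      (‖ℓ‖ * Fintype.card (multiIndices d k)) fun x => by
        obtain ⟨u, rfl⟩ := e.surjective x
        have h1 : ‖ℓ u‖ ≤ ‖ℓ‖ * ‖u‖ := ℓ.le_opNorm u
        have h2 : ‖e u‖ = ‖J u‖ := rfl
        simp only [LinearMap.coe_comp, LinearEquiv.coe_coe, Function.comp_apply,
          LinearEquiv.symm_apply_apply, ContinuousLinearMap.coe_coe]
        rw [h2, mul_assoc]
        exact h1.trans (mul_le_mul_of_nonneg_left (hnorm u) (norm_nonneg _))
  obtain ⟨L, hL, -⟩ := exists_extension_norm_eq _ g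
  refine ⟨fun α => L ∘L ContinuousLinearMap.single ℝ (fun _ => L1Space Ω) α, fun u => ?_⟩
  have h1 : L (J u) = ℓ u := by
    have h2 : g (e u) = ℓ u := congrArg ℓ (e.symm_apply_apply u)
    rw [← h2, ← hL]
    rfl
  have h3 : J u = ∑ α, Pi.single α (weakDerivL α u) :=
    (Finset.univ_sum_single (J u)).symm
  rw [← h1, h3, map_sum]
  rfl

/-- The family of all weak derivatives of order at most `k`, as a map between spaces with their
weak topologies. -/
noncomputable def weakJet (u : WeakSpace ℝ (SobolevW1 Ω k)) (α : multiIndices d k) :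
    WeakSpace ℝ (L1Space Ω) :=
  WeakSpace.map (weakDerivL α) u

theorem continuous_weakJet : Continuous (weakJet : WeakSpace ℝ (SobolevW1 Ω k) → _) :=
  continuous_pi fun α => (WeakSpace.map (weakDerivL α)).continuous

/-- All functionals of `W^{k,1}` factor through the jet via the continuous map `G`, and they induce
the weak topology. -/
theorem isInducing_weakJet : IsInducing (weakJet : WeakSpace ℝ (SobolevW1 Ω k) → _) := by
  choose c hc using exists_dual_eq_sum (Ω := Ω) (k := k)
  let G : (multiIndices d k → WeakSpace ℝ (L1Space Ω)) → StrongDual ℝ (SobolevW1 Ω k) → ℝ :=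
    fun v ℓ => ∑ α, c ℓ α ((toWeakSpace ℝ (L1Space Ω)).symm (v α))
  have hG : Continuous G := continuous_pi fun ℓ => continuous_finsetSum _ fun α _ =>
    (continuous_eval_weakSpace (c ℓ α)).comp (continuous_apply α)
  refine IsInducing.of_comp continuous_weakJet hG ?_
  have hcomp : G ∘ weakJet = fun (u : WeakSpace ℝ (SobolevW1 Ω k))
      (ℓ : StrongDual ℝ (SobolevW1 Ω k)) => ℓ ((toWeakSpace ℝ (SobolevW1 Ω k)).symm u) := by
    funext u ℓ
    exact (hc ℓ _).symm
  rw [hcomp]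
  exact ⟨rfl⟩

theorem zero_mem_multiIndices : (0 : Fin d → ℕ) ∈ multiIndices d k := by
  simp [mem_multiIndices]

theorem weakJet_injective :
    Function.Injective (weakJet : WeakSpace ℝ (SobolevW1 Ω k) → _) := by
  intro u v huv
  have h0 := congrFun huv ⟨0, zero_mem_multiIndices⟩
  have h1 : weakDeriv 0 ((toWeakSpace ℝ (SobolevW1 Ω k)).symm u) =
    weakDeriv 0 ((toWeakSpace ℝ (SobolevW1 Ω k)).symm v) := h0
  rw [weakDeriv_zero_index, weakDeriv_zero_index] at h1
  exact (toWeakSpace ℝ (SobolevW1 Ω k)).symm.injective (toL1_injective h1)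

/-- The component of index zero plays the role of `u`; this turns the range into a set of solutions
of equations in `v`. -/
theorem range_weakJet : Set.range (weakJet : WeakSpace ℝ (SobolevW1 Ω k) → _) =
    {v | ∀ α : multiIndices d k, IsWeakDeriv Ω α
      ((toWeakSpace ℝ (L1Space Ω)).symm (v ⟨0, zero_mem_multiIndices⟩))
      ((toWeakSpace ℝ (L1Space Ω)).symm (v α))} := by
  ext v
  constructor
  · rintro ⟨u, rfl⟩ α
    have h := isWeakDeriv_weakDeriv α.2 ((toWeakSpace ℝ (SobolevW1 Ω k)).symm u)
    rw [← weakDeriv_zero_index] at h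
    exact h
  · intro hv
    let u : SobolevW1 Ω k := ⟨(toWeakSpace ℝ (L1Space Ω)).symm (v ⟨0, zero_mem_multiIndices⟩),
      fun α hα => ⟨_, hv ⟨α, hα⟩⟩⟩
    refine ⟨toWeakSpace ℝ _ u, funext fun α => ?_⟩
    exact (toWeakSpace ℝ (L1Space Ω)).symm.injective (weakDeriv_eq α.2 (hv α))

theorem continuous_integral_mul_test (φ : 𝓓(Ω, ℝ)) : Continuous fun v : WeakSpace ℝ (L1Space Ω) =>
    ∫ x in Ω, (toWeakSpace ℝ (L1Space Ω)).symm v x * φ x := by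
  obtain ⟨C, hC⟩ := φ.continuous.bounded_above_of_compact_support φ.hasCompactSupport
  obtain ⟨ℓ, hℓ⟩ := exists_clm_integral_mul
    (μ := volume.restrict (Ω : Set (EuclideanSpace ℝ (Fin d)))) (g := φ)
    φ.continuous.aestronglyMeasurable (Eventually.of_forall hC)
  refine (continuous_eval_weakSpace ℓ).congr fun v => ?_
  exact hℓ _

/-- Test functions and their derivatives are bounded, so both sides of each defining equation are
weakly continuous in `v`. -/
theorem isClosed_range_weakJet :
    IsClosed (Set.range (weakJet : WeakSpace ℝ (SobolevW1 Ω k) → _)) := by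
  rw [range_weakJet]
  simp only [IsWeakDeriv, Set.ofPred_forall]
  refine isClosed_iInter fun α => isClosed_iInter fun φ => isClosed_eq ?_ ?_
  · exact (continuous_integral_mul_test _).comp (continuous_apply _)
  · exact continuous_const.mul ((continuous_integral_mul_test φ).comp (continuous_apply _))

/-- A set in `W^{k,1}` is relatively weakly compact if and only if each of the sets of weak
derivatives of order at most `k` is relatively weakly compact in `L¹`. -/
theorem isCompact_closure_iff {F : Set (SobolevW1 Ω k)} :
    IsCompact (closure (toWeakSpace ℝ (SobolevW1 Ω k) '' F)) ↔
      ∀ α : multiIndices d k,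
        IsCompact (closure (toWeakSpace ℝ (L1Space Ω) '' (weakDerivL α '' F))) := by
  constructor
  · intro h α
    have hK := h.image (WeakSpace.map (weakDerivL α)).continuous
    refine hK.of_isClosed_subset isClosed_closure (closure_minimal ?_ hK.isClosed)
    rintro _ ⟨_, ⟨f, hf, rfl⟩, rfl⟩
    exact ⟨_, subset_closure ⟨f, hf, rfl⟩, rfl⟩
  · intro h
    have hemb : IsClosedEmbedding (weakJet : WeakSpace ℝ (SobolevW1 Ω k) → _) :=
      ⟨⟨isInducing_weakJet, weakJet_injective⟩, isClosed_range_weakJet⟩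
    -- Tychonoff for the product of the compact closures, pulled back along a closed embedding.
    have hK := hemb.isCompact_preimage (isCompact_univ_pi h)
    refine hK.of_isClosed_subset isClosed_closure (closure_minimal ?_
      ((isClosed_set_pi fun _ _ => isClosed_closure).preimage continuous_weakJet))
    rintro _ ⟨f, hf, rfl⟩ α -
    exact subset_closure ⟨_, ⟨f, hf, rfl⟩, rfl⟩

end SobolevW1

/-! ### Passage between components and sums over multi-indices; the theorem. -/

namespace SobolevW1

open Filter Topology Bornology

variable {d : ℕ} {Ω : Opens (EuclideanSpace ℝ (Fin d))} {k : ℕ}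

theorem setIntegral_norm_restrict_of_subset (v : L1Space Ω) {A : Set (EuclideanSpace ℝ (Fin d))}
    (hA : A ⊆ Ω) :
    ∫ x in A, ‖v x‖ ∂(volume.restrict (Ω : Set (EuclideanSpace ℝ (Fin d)))) =
      ∫ x in A, |v x| := by
  rw [Measure.restrict_restrict_of_subset hA]
  rfl

theorem setIntegral_norm_restrict (v : L1Space Ω) {A : Set (EuclideanSpace ℝ (Fin d))}
    (hA : MeasurableSet A) :
    ∫ x in A, ‖v x‖ ∂(volume.restrict (Ω : Set (EuclideanSpace ℝ (Fin d)))) =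
      ∫ x in A ∩ Ω, |v x| := by
  rw [Measure.restrict_restrict hA]
  rfl

theorem setIntegral_le_sum {α : Fin d → ℕ} (hα : α ∈ multiIndices d k) (f : SobolevW1 Ω k)
    (A : Set (EuclideanSpace ℝ (Fin d))) :
    ∫ x in A, |weakDeriv α f x| ≤ ∑ β ∈ multiIndices d k, ∫ x in A, |weakDeriv β f x| :=
  Finset.single_le_sum (f := fun β => ∫ x in A, |weakDeriv β f x|)
    (fun _ _ => integral_nonneg fun _ => abs_nonneg _) hα

theorem multiIndices_nonempty : (multiIndices d k).Nonempty := ⟨0, zero_mem_multiIndices⟩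

theorem sum_lt_of_forall_lt_div_card {a : (Fin d → ℕ) → ℝ} {ε : ℝ}
    (h : ∀ α ∈ multiIndices d k, a α < ε / (multiIndices d k).card) :
    ∑ α ∈ multiIndices d k, a α < ε := by
  refine (Finset.sum_lt_sum_of_nonempty multiIndices_nonempty h).trans_eq ?_
  have : ((multiIndices d k).card : ℝ) ≠ 0 :=
    Nat.cast_ne_zero.2 (Finset.card_ne_zero.2 multiIndices_nonempty)
  rw [Finset.sum_const, nsmul_eq_mul]
  field_simp

/-- Each component gets the share `ε / card`, and `δ` is the minimum over the finitely many
components. -/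
theorem exists_equiintegrable {F : Set (SobolevW1 Ω k)}
    (h : ∀ α : multiIndices d k,
      IsCompact (closure (toWeakSpace ℝ (L1Space Ω) '' (weakDerivL α '' F)))) {ε : ℝ}
    (hε : 0 < ε) :
    ∃ δ > 0, ∀ f ∈ F, ∀ A : Set (EuclideanSpace ℝ (Fin d)), A ⊆ Ω →
      NullMeasurableSet A volume → volume A < ENNReal.ofReal δ →
      (∑ α ∈ multiIndices d k, ∫ x in A, |f.weakDeriv α x|) < ε := by
  have hε' : 0 < ε / (multiIndices d k).card :=
    div_pos hε (Nat.cast_pos.2 (Finset.card_pos.2 multiIndices_nonempty))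
  choose δ hδ hδA using fun α => exists_pos_forall_setIntegral_norm_lt (h α) hε'
  have : Nonempty (multiIndices d k) := multiIndices_nonempty.to_subtype
  refine ⟨Finset.univ.inf' Finset.univ_nonempty δ, (Finset.lt_inf'_iff _).2 fun α _ => hδ α,
    fun f hf A hAΩ hA hvol => sum_lt_of_forall_lt_div_card fun α hα => ?_⟩
  have h1 := hδA ⟨α, hα⟩ _ ⟨f, hf, rfl⟩ A (hA.mono_ac Measure.absolutelyContinuous_restrict)
    ((Measure.restrict_apply_le _ _).trans_lt (hvol.trans_le
      (ENNReal.ofReal_le_ofReal (Finset.inf'_le _ (Finset.mem_univ _)))))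
  rwa [setIntegral_norm_restrict_of_subset _ hAΩ] at h1

/-- A finite union of the sets found for the components still has finite measure. -/
theorem exists_tight {F : Set (SobolevW1 Ω k)}
    (h : ∀ α : multiIndices d k,
      IsCompact (closure (toWeakSpace ℝ (L1Space Ω) '' (weakDerivL α '' F)))) {ε : ℝ}
    (hε : 0 < ε) :
    ∃ w : Set (EuclideanSpace ℝ (Fin d)),
      (w ⊆ Ω ∧ NullMeasurableSet w volume ∧ volume w < ⊤) ∧ ∀ f ∈ F,
      (∑ α ∈ multiIndices d k,
        ∫ x in (Ω : Set (EuclideanSpace ℝ (Fin d))) \ w, |f.weakDeriv α x|) < ε := by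
  have hε' : 0 < ε / (multiIndices d k).card :=
    div_pos hε (Nat.cast_pos.2 (Finset.card_pos.2 multiIndices_nonempty))
  choose w hw hwμ hwF using fun α => exists_forall_setIntegral_compl_norm_lt (h α) hε'
  have hΩ := Ω.isOpen.measurableSet
  refine ⟨⋃ α, w α ∩ Ω, ⟨Set.iUnion_subset fun α => Set.inter_subset_right,
    (MeasurableSet.iUnion fun α => (hw α).inter hΩ).nullMeasurableSet, ?_⟩,
    fun f hf => sum_lt_of_forall_lt_div_card fun α hα => ?_⟩
  · refine (measure_iUnion_fintype_le _ _).trans_lt (ENNReal.sum_lt_top.2 fun α _ => ?_)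
    rw [← Measure.restrict_apply (hw α)]
    exact hwμ α
  · have h1 := hwF ⟨α, hα⟩ _ ⟨f, hf, rfl⟩
    rw [setIntegral_norm_restrict _ (hw _).compl] at h1
    have hsub : (Ω : Set (EuclideanSpace ℝ (Fin d))) \ ⋃ α, w α ∩ Ω ⊆ (w ⟨α, hα⟩)ᶜ ∩ Ω :=
      fun x hx => ⟨fun hxw => hx.2 (Set.mem_iUnion.2 ⟨⟨α, hα⟩, hxw, hx.1⟩), hx.1⟩
    refine lt_of_le_of_lt (setIntegral_mono_set ?_ (Eventually.of_forall fun _ => abs_nonneg _)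
      (Eventually.of_forall hsub)) h1
    exact IntegrableOn.mono_set (L1.integrable_coeFn (weakDeriv α f)).abs Set.inter_subset_right

end SobolevW1

open SobolevW1 in
theorem theorem1p2 (d k : ℕ) (hd : 1 ≤ d) (Ω : Opens (EuclideanSpace ℝ (Fin d)))
    (hΩ : (Ω : Set (EuclideanSpace ℝ (Fin d))).Nonempty) (F : Set (SobolevW1 Ω k)) :
    ((∃ M : ℝ, 0 < M ∧ ∀ f ∈ F, ‖f‖ ≤ M) ∧
      (∃ δ : ℝ → ℝ, (∀ ε, 0 < ε → 0 < δ ε) ∧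
        ∀ f ∈ F, ∀ ε, 0 < ε → ∀ A : Set (EuclideanSpace ℝ (Fin d)), A ⊆ Ω →
          -- `A` is Lebesgue measurable
          NullMeasurableSet A volume →
          volume A < ENNReal.ofReal (δ ε) →
          (∑ α ∈ multiIndices d k, ∫ x in A, |f.weakDeriv α x|) < ε) ∧
      (∃ ω : ℝ → Set (EuclideanSpace ℝ (Fin d)),
        (∀ ε, 0 < ε → ω ε ⊆ Ω ∧ NullMeasurableSet (ω ε) volume ∧ volume (ω ε) < ⊤) ∧
        ∀ f ∈ F, ∀ ε, 0 < ε →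
          (∑ α ∈ multiIndices d k,
            ∫ x in (Ω : Set (EuclideanSpace ℝ (Fin d))) \ ω ε, |f.weakDeriv α x|) < ε)) ↔
    -- the closure of `F` in the weak topology is weakly compact
    IsCompact (closure (toWeakSpace ℝ (SobolevW1 Ω k) '' F)) := by
  constructor
  · rintro ⟨⟨M, -, hM⟩, ⟨δ, hδ, hδF⟩, ω, hω, hωF⟩
    refine isCompact_closure_iff.2 fun α => isCompact_closure_toWeakSpace_L1 ?_ ?_ ?_
    · refine isBounded_iff_forall_norm_le.2 ⟨M, ?_⟩
      rintro _ ⟨f, hf, rfl⟩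
      exact (norm_weakDeriv_le α.2 f).trans (hM f hf)
    · refine fun ε hε => ⟨δ ε, hδ ε hε, ?_⟩
      rintro _ ⟨f, hf, rfl⟩ A hA hvol
      rw [Measure.restrict_apply hA] at hvol
      rw [setIntegral_norm_restrict _ hA]
      exact (setIntegral_le_sum α.2 f _).trans_lt (hδF f hf ε hε _ Set.inter_subset_right
        (hA.inter Ω.isOpen.measurableSet).nullMeasurableSet hvol)
    · intro ε hε
      obtain ⟨-, hωm, hωv⟩ := hω ε hε
      -- The `L¹` criterion asks for a Borel set, so the Lebesgue measurable `ω ε` is replaced by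
      -- one that agrees with it a.e.
      obtain ⟨w, -, hw, hae⟩ := hωm.exists_measurable_superset_ae_eq
      refine ⟨w, hw, ?_, ?_⟩
      · refine ((Measure.restrict_apply_le _ _).trans_lt ?_).ne
        rwa [measure_congr hae]
      · rintro _ ⟨f, hf, rfl⟩
        rw [setIntegral_norm_restrict _ hw.compl, Set.inter_comm, ← Set.sdiff_eq,
          setIntegral_congr_set ((ae_eq_refl _).diff hae)]
        exact (setIntegral_le_sum α.2 f _).trans_lt (hωF f hf ε hε)
  · intro h
    have hα := isCompact_closure_iff.1 h
    refine ⟨?_, ?_, ?_⟩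
    · obtain ⟨M, hM, hMF⟩ := (isBounded_of_isCompact_closure_toWeakSpace h).exists_pos_norm_le
      exact ⟨M, hM, hMF⟩
    -- The values of `δ` at `ε ≤ 0` are arbitrary; the same holds for `ω` below.
    · choose! δ hδ hδF using fun ε (hε : 0 < ε) => exists_equiintegrable hα hε
      exact ⟨δ, hδ, fun f hf ε hε => hδF ε hε f hf⟩
    · choose! ω hω hωF using fun ε (hε : 0 < ε) => exists_tight hα hε
      exact ⟨ω, hω, fun f hf ε hε => hωF ε hε f hf⟩
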